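/- Let $\mathfrak g$ be a finite-dimensional reductive complex Lie algebra, and fix a nondegenerate symmetric invariant bilinear form $B$ on $\mathfrak g$ (for instance the Killing form, if $\mathfrak g$ is semisimple). Let $T(\mathfrak g)$ be the tensor algebra, $S(\mathfrak g)\subset T(\mathfrak g)$ the space of symmetric tensors, $A^{n}(\mathfrak g)\subset T(\mathfrak g)$ the space of alternating tensors of degree $n$, and $A^{even}(\mathfrak g)=\bigoplus_k A^{2k}(\mathfrak g)$. Let $\tau:T(\mathfrak g)\to U(\mathfrak g)$, $\tau_S:T(\mathfrak g)\to P(\mathfrak g)$ and $\tau_A:T(\mathfrak g)\to\wedge\mathfrak g$ be the quotient maps onto the universal enveloping algebra, the symmetric algebra and the exterior algebra. By the Poincaré–Birkhoff–Witt theorem, for every $t\in A^{even}(\mathfrak g)$ there is a unique $\Gamma_T(t)\in S(\mathfrak g)$ with $\tau(\Gamma_T(t))=\tau(t)$. Since $\tau_A$ maps $A^{even}(\mathfrak g)$ bijectively onto $\wedge^{even}\mathfrak g$, there is a unique map $\Gamma:\wedge^{even}\mathfrak g\to P(\mathfrak g)$ with $\Gamma(\tau_A(t))=\tau_S(\Gamma_T(t))$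 for all $t\in A^{even}(\mathfrak g)$. For an integer $k\ge 0$ let $R^k(\mathfrak g)=\Gamma(\wedge^{2k}\mathfrak g)$. Regard the elements of $P(\mathfrak g)$ as polynomial functions on $\mathfrak g$ by identifying $y\in\mathfrak g$ with the linear function $B(y,\cdot)$, and let $\mathrm{Var}\,R^k(\mathfrak g)=\{x\in\mathfrak g : p(x)=0\ \forall p\in R^k(\mathfrak g)\}$. For $j\ge 0$ let $\mathfrak g^{(2j)}=\{x\in\mathfrak g : \dim[\mathfrak g,x]=2j\}$; a $2j$-sheet of $\mathfrak g$ is an irreducible component of $\mathfrak g^{(2j)}$ in the Zariski topology. Then for every integer $k\ge 0$ $$\mathrm{Var}\,R^k(\mathfrak g)=\bigcup_{0\le j<k}\mathfrak g^{(2j)}.$$ Equivalently, $\mathrm{Var}\,R^k(\mathfrak g)$ is the set of all $x\in\mathfrak g$ whose orbit $G\cdot x\cong G/G_x$ under the adjoint group $G$ (the subgroup of $GL(\mathfrak g)$ generated by all $\exp(\mathrm{ad}\,y)$, $y\in\mathfrak g$) has complex dimension less than $2k$; it is also the union of all $2j$-sheets of $\mathfrak g$ with $0\le j<k$. -/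

import Mathlib

open scoped TensorProduct

namespace Kostant

section Gamma

variable (𝔤 : Type*) [LieRing 𝔤] [LieAlgebra ℂ 𝔤]

/-- `S^n(𝔤) ⊆ T(𝔤)`: the symmetric tensors of degree `n`, i.e. the tensors in `𝔤 ⊗ ⋯ ⊗ 𝔤`
that are fixed by all permutations of the factors. -/
noncomputable def symTensors (n : ℕ) : Submodule ℂ (TensorAlgebra ℂ 𝔤) :=
  Submodule.map (TensorPower.toTensorAlgebra (R := ℂ) (M := 𝔤) (n := n))
    (⨅ σ : Equiv.Perm (Fin n),
      LinearMap.eqLocus (PiTensorProduct.reindex ℂ (fun _ : Fin n => 𝔤) σ).toLinearMap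
        LinearMap.id)

/-- `A^n(𝔤) ⊆ T(𝔤)`: the alternating tensors of degree `n`, i.e. the tensors in `𝔤 ⊗ ⋯ ⊗ 𝔤`
on which every permutation of the factors acts by its sign. -/
noncomputable def altTensors (n : ℕ) : Submodule ℂ (TensorAlgebra ℂ 𝔤) :=
  Submodule.map (TensorPower.toTensorAlgebra (R := ℂ) (M := 𝔤) (n := n))
    (⨅ σ : Equiv.Perm (Fin n),
      LinearMap.eqLocus (PiTensorProduct.reindex ℂ (fun _ : Fin n => 𝔤) σ).toLinearMap
        (((Equiv.Perm.sign σ : ℤˣ) : ℤ) • LinearMap.id))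

/-- The space `S(𝔤) ⊆ T(𝔤)` of symmetric tensors. -/
noncomputable def allSymTensors : Submodule ℂ (TensorAlgebra ℂ 𝔤) := ⨆ n : ℕ, symTensors 𝔤 n

/-- The space `A^even(𝔤) ⊆ T(𝔤)` spanned by the alternating tensors of even degree. -/
noncomputable def evenAltTensors : Submodule ℂ (TensorAlgebra ℂ 𝔤) :=
  ⨆ k : ℕ, altTensors 𝔤 (2 * k)

/-- The quotient map `τ : T(𝔤) → U(𝔤)`. -/
noncomputable def τ : TensorAlgebra ℂ 𝔤 →ₐ[ℂ] UniversalEnvelopingAlgebra ℂ 𝔤 :=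
  UniversalEnvelopingAlgebra.mkAlgHom ℂ 𝔤

/-- The quotient map from `T(𝔤)` to the symmetric algebra `P(𝔤)`; its restriction to the
symmetric tensors is `τ_S`. -/
noncomputable def τS : TensorAlgebra ℂ 𝔤 →ₐ[ℂ] SymmetricAlgebra ℂ 𝔤 :=
  SymmetricAlgebra.algHom ℂ 𝔤

/-- The quotient map from `T(𝔤)` to the exterior algebra `∧𝔤`; its restriction to the even
alternating tensors is `τ_A`. -/
noncomputable def τA : TensorAlgebra ℂ 𝔤 →ₐ[ℂ] ExteriorAlgebra ℂ 𝔤 :=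
  TensorAlgebra.toExterior

variable {𝔤}

/-- `Γ_T t` is the symmetric tensor `s ∈ S(𝔤)` with `τ s = τ t`. It exists and is unique by the
Poincaré–Birkhoff–Witt theorem: `τ` restricts to a bijection from `S(𝔤)` onto `U(𝔤)`. -/
noncomputable def ΓT (t : TensorAlgebra ℂ 𝔤) : TensorAlgebra ℂ 𝔤 :=
  Function.invFunOn (τ 𝔤) (allSymTensors 𝔤 : Set (TensorAlgebra ℂ 𝔤)) (τ 𝔤 t)

/-- The map `Γ : ∧^even 𝔤 → P(𝔤)` with `τ_S ∘ Γ_T = Γ ∘ τ_A` on `A^even(𝔤)`: an element `u` of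
`∧^even 𝔤` is lifted to the element of `A^even(𝔤)` that `τ_A` sends to `u` (`τ_A` restricts to a
bijection from `A^even(𝔤)` onto `∧^even 𝔤`). Only the values on `∧^even 𝔤` are meaningful. -/
noncomputable def Γ (u : ExteriorAlgebra ℂ 𝔤) : SymmetricAlgebra ℂ 𝔤 :=
  τS 𝔤 (ΓT (Function.invFunOn (τA 𝔤) (evenAltTensors 𝔤 : Set (TensorAlgebra ℂ 𝔤)) u))

variable (𝔤)

/-- `R^k(𝔤)`, the image of `Γ : ∧^{2k} 𝔤 → P(𝔤)`. -/
noncomputable def R (k : ℕ) : Set (SymmetricAlgebra ℂ 𝔤) :=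
  Γ '' (⋀[ℂ]^(2 * k) 𝔤 : Set (ExteriorAlgebra ℂ 𝔤))

variable {𝔤}

/-- The value at `x` of `p ∈ P(𝔤)`, regarded as a polynomial function on `𝔤` by identifying
`y ∈ 𝔤` with the linear function `B(y, ·)`. -/
noncomputable def evalAt (B : LinearMap.BilinForm ℂ 𝔤) (x : 𝔤) : SymmetricAlgebra ℂ 𝔤 →ₐ[ℂ] ℂ :=
  SymmetricAlgebra.lift (B.flip x)

/-- The common zero set in `𝔤` of a set of elements of `P(𝔤)`, regarded as polynomial functions
on `𝔤` through the bilinear form `B`. -/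
def Var (B : LinearMap.BilinForm ℂ 𝔤) (F : Set (SymmetricAlgebra ℂ 𝔤)) : Set 𝔤 :=
  {x | ∀ p ∈ F, evalAt B x p = 0}

end Gamma

section Sheets

variable (𝔤 : Type*) [LieRing 𝔤] [LieAlgebra ℂ 𝔤]

/-- `𝔤^{(d)}`: the set of `x ∈ 𝔤` such that `[𝔤, x]` (the image of `ad x`) has dimension `d`. -/
def stratum (d : ℕ) : Set 𝔤 :=
  {x | Module.finrank ℂ (LinearMap.range (LieAlgebra.ad ℂ 𝔤 x)) = d}

/-- The algebra of polynomial functions on `𝔤`, generated by the linear functions. -/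
def polyFun : Subalgebra ℂ (𝔤 → ℂ) :=
  Algebra.adjoin ℂ (Set.range (fun (φ : Module.Dual ℂ 𝔤) (x : 𝔤) => φ x))

/-- The Zariski topology of the vector space `𝔤`: its basic open sets are the non-vanishing loci
of the polynomial functions. -/
@[reducible] def zariski : TopologicalSpace 𝔤 :=
  TopologicalSpace.generateFrom {U | ∃ p ∈ polyFun 𝔤, U = {x | p x ≠ 0}}

/-- The `d`-sheets of `𝔤`: the irreducible components of `𝔤^{(d)}` for the topology induced by
the Zariski topology of `𝔤`. -/
def sheets (d : ℕ) : Set (Set 𝔤) :=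
  (fun C : Set (stratum 𝔤 d) => (Subtype.val '' C : Set 𝔤)) ''
    @irreducibleComponents (stratum 𝔤 d)
      (TopologicalSpace.induced (Subtype.val : stratum 𝔤 d → 𝔤) (zariski 𝔤))

end Sheets

section Orbits

variable (𝔤 : Type*) [LieRing 𝔤] [LieAlgebra ℂ 𝔤] [FiniteDimensional ℂ 𝔤]

variable {𝔤} in
/-- The exponential of an endomorphism of the finite-dimensional space `𝔤` (the matrix
exponential in a basis; it does not depend on the basis). -/
noncomputable def expEnd (f : Module.End ℂ 𝔤) : Module.End ℂ 𝔤 :=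
  Matrix.toLin (Module.finBasis ℂ 𝔤) (Module.finBasis ℂ 𝔤)
    (NormedSpace.exp (LinearMap.toMatrix (Module.finBasis ℂ 𝔤) (Module.finBasis ℂ 𝔤) f))

/-- The adjoint group of `𝔤`: the subgroup of `GL(𝔤)` generated by all `exp (ad y)`, `y ∈ 𝔤`. -/
noncomputable def adjointGroup : Subgroup (Module.End ℂ 𝔤)ˣ :=
  Subgroup.closure {u | ∃ y : 𝔤, (u : Module.End ℂ 𝔤) = expEnd (LieAlgebra.ad ℂ 𝔤 y)}

variable {𝔤}

/-- The Lie algebra of the stabilizer `G_x` of `x` in the adjoint group `G`, pulled back to `𝔤`: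
all `y ∈ 𝔤` whose one-parameter group `t ↦ exp (t ad y)` stays in `G_x`. (This set is a linear
subspace; taking its span makes it one by construction.) -/
noncomputable def isotropyAlgebra (x : 𝔤) : Submodule ℂ 𝔤 :=
  Submodule.span ℂ {y | ∀ t : ℝ, ∃ g ∈ MulAction.stabilizer (adjointGroup 𝔤) x,
    ((g : (Module.End ℂ 𝔤)ˣ) : Module.End ℂ 𝔤) = expEnd (LieAlgebra.ad ℂ 𝔤 ((t : ℂ) • y))}

/-- The (complex) dimension of the adjoint orbit `G · x`, as the homogeneous space `G / G_x` of
the adjoint group: the dimension of the quotient of `𝔤` by the Lie algebra of the stabilizer. -/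
noncomputable def orbitDim (x : 𝔤) : ℕ := Module.finrank ℂ (𝔤 ⧸ isotropyAlgebra x)

end Orbits

end Kostant

/-! For `x` in `𝔤` let `ω_x(y, z) = B([y, z], x)`. In `U(𝔤)` one has `[a, b] = ab - ba`, so the
alternating sum of the products `v₁ ⋯ v₂ₖ` over all orderings is `2⁻ᵏ` times the alternating sum of
`[v₁, v₂] ⋯ [v₂ₖ₋₁, v₂ₖ]` (`tau_bracketTensor`). The second sum comes from a symmetric tensor,
because permuting whole pairs is an even permutation (`bracketTensor_mem_symTensors`). This gives
`Γ_T` explicitly, and the values at `x` of the elements of `R^k` are, up to nonzero scalars and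
linear combinations, the values of the `k`-th Pfaffian of `ω_x`, that is, of `ω_x^{∧k}`
(`evalAt_Gamma`). Hence `x` lies in `Var R^k` iff `ω_x^{∧k} = 0`, iff `rank ω_x < 2k`
(`pfaffian_eq_zero_iff`). Since `B` is invariant and nondegenerate, `rank ω_x = dim [𝔤, x]`
(`finrank_range_kirillovForm`); it is even because `ω_x` is alternating. The orbit form follows
because the Lie algebra of `G_x` is the kernel of `ad x`; the sheet form, because a space is the
union of its irreducible components.

The explicit tensor is the chosen value `ΓT` only if `τ` is injective on symmetric tensors. This
half of Poincaré–Birkhoff–Witt is proved directly for reductive `𝔤`: vector fields on matrices times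
an affine space represent `𝔤`, and enough functions serve as coordinates at the identity for their
symbols to be read off (`tau_injOn_of_coordinates`, `exists_coordinate`). -/

namespace Kostant

/-! ### Linear forms on a reductive Lie algebra: Killing form plus characters. -/

section Form

variable {𝔤 : Type*} [LieRing 𝔤] [LieAlgebra ℂ 𝔤] [FiniteDimensional ℂ 𝔤]

/-- The kernel of the Killing form of a reductive Lie algebra is central. -/
theorem lie_eq_zero_of_killingForm_eq_zero [LieAlgebra.HasCentralRadical ℂ 𝔤] {x : 𝔤}
    (hx : ∀ y, killingForm ℂ 𝔤 x y = 0) (y : 𝔤) : ⁅y, x⁆ = 0 := by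
  have h : x ∈ LieAlgebra.center ℂ 𝔤 := by
    rw [← LieAlgebra.HasCentralRadical.radical_eq_center]
    apply LieAlgebra.killingCompl_top_le_radical ℂ 𝔤
    rw [LieIdeal.mem_killingCompl]
    intro y _
    rw [LieModule.traceForm_comm]
    exact hx y
  exact (LieModule.mem_maxTrivSubmodule ℂ 𝔤 𝔤 x).1 h y

/-- For a reductive Lie algebra with nondegenerate invariant form `B`, each linear form is the sum
of `killingForm x` for some `x` and of a character. -/
theorem exists_killingForm_add [LieAlgebra.HasCentralRadical ℂ 𝔤]
    (B : LinearMap.BilinForm ℂ 𝔤) (hB_nondeg : B.Nondegenerate)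
    (hB_inv : B.lieInvariant 𝔤) (ξ : Module.Dual ℂ 𝔤) :
    ∃ x c : 𝔤, (∀ a b : 𝔤, B c ⁅a, b⁆ = 0) ∧ ∀ y, ξ y = killingForm ℂ 𝔤 x y + B c y := by
  let K : 𝔤 →ₗ[ℂ] 𝔤 := (B.toDual hB_nondeg).symm.toLinearMap ∘ₗ killingForm ℂ 𝔤
  have hK : ∀ x y, B (K x) y = killingForm ℂ 𝔤 x y := fun x y =>
    LinearMap.BilinForm.apply_toDual_symm_apply (hB := hB_nondeg) (killingForm ℂ 𝔤 x) y
  have hker : ∀ x ∈ LinearMap.ker K, ∀ y, ⁅y, x⁆ = 0 := fun x hx y => by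
    refine lie_eq_zero_of_killingForm_eq_zero (fun z => ?_) y
    rw [← hK, LinearMap.mem_ker.1 hx, map_zero, LinearMap.zero_apply]
  -- If `K x` is central, invariance puts every `[x, y]` in the kernel of the Killing form, so `[x,
  -- y]` is central. Then `ad y ∘ ad x = 0` for all `y`, and its trace gives `K x = 0`. By dimension
  -- count `𝔤 = ker K ⊕ range K`.
  have hdisj : Disjoint (LinearMap.ker K) (LinearMap.range K) := by
    rw [Submodule.disjoint_def]
    rintro _ hx ⟨x, rfl⟩
    have hc := hker _ hx
    have hxy : ∀ y z : 𝔤, ⁅z, ⁅x, y⁆⁆ = 0 := by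
      intro y
      apply lie_eq_zero_of_killingForm_eq_zero
      intro w
      rw [LieModule.traceForm_apply_lie_apply, ← hK]
      have := hB_inv y (K x) w
      rw [hc y, map_zero, LinearMap.zero_apply] at this
      exact neg_eq_zero.1 this.symm
    have hkill : killingForm ℂ 𝔤 x = 0 := by
      ext y
      rw [LieModule.traceForm_comm, LieModule.traceForm_apply_apply]
      have : (LieModule.toEnd ℂ 𝔤 𝔤 y) ∘ₗ (LieModule.toEnd ℂ 𝔤 𝔤 x) = 0 := by
        ext w
        exact hxy w y
      rw [this, map_zero, LinearMap.zero_apply]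
    change (B.toDual hB_nondeg).symm (killingForm ℂ 𝔤 x) = 0
    rw [hkill, map_zero]
  have htop := Submodule.eq_top_of_disjoint _ _
    (by rw [add_comm, LinearMap.finrank_range_add_finrank_ker]) hdisj
  have hmem : (B.toDual hB_nondeg).symm ξ ∈ LinearMap.ker K ⊔ LinearMap.range K := by
    rw [htop]; trivial
  obtain ⟨c, hc, _, ⟨x, rfl⟩, h⟩ := Submodule.mem_sup.1 hmem
  refine ⟨x, c, fun a b => ?_, fun y => ?_⟩
  · have := hB_inv a c b
    rw [hker c hc a, map_zero, LinearMap.zero_apply] at this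
    exact neg_eq_zero.1 this.symm
  · rw [← LinearMap.BilinForm.apply_toDual_symm_apply (hB := hB_nondeg) ξ y, ← h, map_add,
      LinearMap.add_apply, hK, add_comm]

end Form

/-! ### Iterated derivations and the action of `U(𝔤)` by differential operators. -/

section VectorFields

attribute [local instance] LieRing.ofAssociativeRing

variable {𝔤 : Type*} [LieRing 𝔤] [LieAlgebra ℂ 𝔤]
  {C : Type*} [CommRing C] [Algebra ℂ C] (L : 𝔤 →ₗ⁅ℂ⁆ Derivation ℂ C C) (ε : C →ₐ[ℂ] ℂ)

/-- `iterDer L [y₁, …, yₙ] f = L yₙ (⋯ (L y₁ f))`. -/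
def iterDer : List 𝔤 → C →ₗ[ℂ] C
  | [] => LinearMap.id
  | y :: l => iterDer l ∘ₗ (L y : C →ₗ[ℂ] C)

theorem iterDer_append (l₁ l₂ : List 𝔤) :
    iterDer L (l₁ ++ l₂) = iterDer L l₂ ∘ₗ iterDer L l₁ := by
  induction l₁ with
  | nil => rfl
  | cons y l ih => rw [List.cons_append, iterDer, ih, iterDer, LinearMap.comp_assoc]

/-- The indices other than `p` are listed as `swap 0 p j.succ` to match `Equiv.Perm.decomposeFin`,
which drives the induction in `iterDer_mul_prod`. -/
theorem derivation_prod (D : Derivation ℂ C C) {n : ℕ} (f : Fin (n + 1) → C) :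
    D (∏ i, f i) = ∑ p, D (f p) * ∏ j : Fin n, f (Equiv.swap 0 p j.succ) := by
  have key : ∀ s : Finset (Fin (n + 1)),
      D (∏ i ∈ s, f i) = ∑ p ∈ s, D (f p) * ∏ j ∈ s.erase p, f j := by
    intro s
    induction s using Finset.induction_on with
    | empty => simp
    | insert a s ha ih =>
      rw [Finset.prod_insert ha, Derivation.leibniz, ih, Finset.sum_insert ha,
        Finset.erase_insert ha, add_comm, smul_eq_mul, smul_eq_mul, Finset.mul_sum,
        mul_comm (∏ i ∈ s, f i)]
      congr 1
      refine Finset.sum_congr rfl fun p hp => ?_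
      have hpa : a ≠ p := fun h => ha (h ▸ hp)
      rw [Finset.erase_insert_of_ne hpa, Finset.prod_insert (by simp [ha])]
      ring
  rw [key]
  refine Finset.sum_congr rfl fun p _ => ?_
  congr 1
  have h := Equiv.prod_comp (Equiv.swap 0 p) (fun i => if i = p then (1 : C) else f i)
  rw [Fin.prod_univ_succ, Equiv.swap_apply_left, if_pos rfl, one_mul] at h
  rw [← Finset.filter_ne', Finset.prod_filter]
  simp only [ne_eq, ite_not]
  rw [← h]
  refine Finset.prod_congr rfl fun j _ => ?_
  rw [if_neg]
  intro h'
  rw [Equiv.swap_apply_eq_iff, Equiv.swap_apply_right] at h'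
  exact Fin.succ_ne_zero j h'

theorem derivation_mul_prod (D : Derivation ℂ C C) {n : ℕ} (g : C) (f : Fin (n + 1) → C) :
    D (g * ∏ i, f i) = D g * ∏ i, f i +
      ∑ p, (g * D (f p)) * ∏ j : Fin n, f (Equiv.swap 0 p j.succ) := by
  rw [Derivation.leibniz, derivation_prod, smul_eq_mul, smul_eq_mul, Finset.mul_sum, add_comm,
    mul_comm (∏ i, f i)]
  simp only [mul_assoc]

/-- A product of more functions vanishing at a point than there are derivatives vanishes there. -/
theorem iterDer_mul_prod_of_lt (l : List 𝔤) : ∀ {n : ℕ}, l.length < n → ∀ (g : C) (f : Fin n → C),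
    (∀ i, ε (f i) = 0) → ε (iterDer L l (g * ∏ i, f i)) = 0 := by
  induction l with
  | nil =>
    intro n hn g f hf
    have : ∏ i, ε (f i) = 0 := Finset.prod_eq_zero (Finset.mem_univ ⟨0, hn⟩) (hf _)
    simp [iterDer, this]
  | cons y l ih =>
    intro n hn g f hf
    obtain _ | n := n
    · simp at hn
    have hn' : l.length < n := by simpa using hn
    change ε (iterDer L l (L y _)) = 0
    rw [derivation_mul_prod, map_add, map_add, ih (hn'.trans n.lt_succ_self) _ _ hf, zero_add,
      map_sum, map_sum]
    exact Finset.sum_eq_zero fun p _ => ih hn' _ _ fun j => hf _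

/-- With as many derivatives as vanishing factors, a term survives only if each factor is hit
exactly once. So only first derivatives at the point enter, and noncommutativity is invisible. -/
theorem iterDer_mul_prod {n : ℕ} (y : Fin n → 𝔤) (g : C) (f : Fin n → C)
    (hf : ∀ i, ε (f i) = 0) :
    ε (iterDer L (List.ofFn y) (g * ∏ i, f i)) =
      ε g * ∑ σ : Equiv.Perm (Fin n), ∏ i, ε (L (y i) (f (σ i))) := by
  induction n generalizing g with
  | zero => simp [iterDer]
  | succ n ih =>
    rw [List.ofFn_succ]
    change ε (iterDer L _ (L (y 0) _)) = _
    rw [derivation_mul_prod, map_add, map_add,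
      iterDer_mul_prod_of_lt L ε _ (by simp) _ _ hf, zero_add, map_sum, map_sum,
      ← Equiv.sum_comp Equiv.Perm.decomposeFin.symm, Fintype.sum_prod_type, Finset.mul_sum]
    refine Finset.sum_congr rfl fun p _ => ?_
    rw [ih (fun i => y i.succ) _ _ fun j => hf _, map_mul, mul_assoc, Finset.mul_sum]
    congr 1
    refine Finset.sum_congr rfl fun σ _ => ?_
    simp [Fin.prod_univ_succ]

/-- The action of `U(𝔤)` by differential operators. -/
noncomputable def diffOp : UniversalEnvelopingAlgebra ℂ 𝔤 →ₐ[ℂ] Module.End ℂ C :=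
  UniversalEnvelopingAlgebra.lift ℂ
    { toFun := fun y => (L y : C →ₗ[ℂ] C)
      map_add' := fun a b => by ext; simp
      map_smul' := fun a b => by ext; simp
      map_lie' := fun {a b} => by
        ext f
        simp [LieRing.of_associative_ring_bracket] }

/-- The reversal arises because the last factor of a product of operators acts first, whereas
`iterDer` applies the head of the list first. -/
theorem diffOp_tau_tprod {n : ℕ} (y : Fin n → 𝔤) (f : C) :
    diffOp L (τ 𝔤 (TensorAlgebra.tprod ℂ 𝔤 n y)) f =
      iterDer L (List.ofFn fun i => y (Fin.rev i)) f := by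
  have key : ∀ l : List 𝔤, diffOp L (τ 𝔤 (l.map (TensorAlgebra.ι ℂ)).prod) =
      iterDer L l.reverse := by
    intro l
    induction l with
    | nil => rw [List.map_nil, List.prod_nil, map_one, map_one]; rfl
    | cons a l ih =>
      rw [List.map_cons, List.prod_cons, map_mul, map_mul, ih, List.reverse_cons, iterDer_append]
      congr 1
      exact UniversalEnvelopingAlgebra.lift_ι_apply ℂ _ a
  have h1 : (List.ofFn fun i => TensorAlgebra.ι ℂ (y i)) =
      (List.ofFn y).map (TensorAlgebra.ι ℂ) := by
    rw [List.map_ofFn]; rfl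
  have h2 : (List.ofFn y).reverse = List.ofFn fun i => y (Fin.rev i) := by
    apply List.ext_getElem
    · simp
    intro i h1 h2
    simp only [List.getElem_reverse, List.getElem_ofFn]
    congr 1
    ext
    simp [Fin.rev]
    omega
  rw [TensorAlgebra.tprod_apply, h1, key, h2]

end VectorFields

/-! ### Injectivity of `τ` on symmetric tensors, from local coordinates. -/

section Injective

variable {𝔤 : Type*} [LieRing 𝔤] [LieAlgebra ℂ 𝔤]

/-- The functional `y₁ ⊗ ⋯ ⊗ yₙ ↦ ∏ ξᵢ(yᵢ)`. -/
noncomputable def prodDual {n : ℕ} (ξ : Fin n → Module.Dual ℂ 𝔤) : (⨂[ℂ]^n 𝔤) →ₗ[ℂ] ℂ :=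
  PiTensorProduct.lift ((MultilinearMap.mkPiAlgebra ℂ (Fin n) ℂ).compLinearMap ξ)

theorem prodDual_tprod {n : ℕ} (ξ : Fin n → Module.Dual ℂ 𝔤) (y : Fin n → 𝔤) :
    prodDual ξ (PiTensorProduct.tprod ℂ y) = ∏ i, ξ i (y i) := by
  simp [prodDual]

theorem eq_zero_of_prodDual_eq_zero [FiniteDimensional ℂ 𝔤] {n : ℕ} {a : ⨂[ℂ]^n 𝔤}
    (h : ∀ ξ : Fin n → Module.Dual ℂ 𝔤, prodDual ξ a = 0) : a = 0 := by
  let b := Module.finBasis ℂ 𝔤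
  refine (Basis.piTensorProduct fun _ : Fin n => b).ext_elem fun p => ?_
  have key : (Basis.piTensorProduct fun _ : Fin n => b).coord p =
      prodDual fun i => b.coord (p i) := by
    ext y
    simp only [LinearMap.compMultilinearMap_apply, prodDual_tprod, Module.Basis.coord_apply,
      Basis.piTensorProduct_repr_tprod_apply]
  rw [map_zero, Finsupp.zero_apply, ← Module.Basis.coord_apply, key, h]

variable {C : Type*} [CommRing C] [Algebra ℂ C] (L : 𝔤 →ₗ⁅ℂ⁆ Derivation ℂ C C) (ε : C →ₐ[ℂ] ℂ)

/-- The functional `t ↦ (τ(t) · f)(ε)` on the tensor algebra. -/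
noncomputable def evalDiffOp (f : C) : TensorAlgebra ℂ 𝔤 →ₗ[ℂ] ℂ :=
  ε.toLinearMap ∘ₗ LinearMap.applyₗ f ∘ₗ (diffOp L).toLinearMap ∘ₗ (τ 𝔤).toLinearMap

theorem evalDiffOp_tprod {n : ℕ} (y : Fin n → 𝔤) (f : C) :
    evalDiffOp L ε f (TensorAlgebra.tprod ℂ 𝔤 n y) =
      ε (iterDer L (List.ofFn fun i => y (Fin.rev i)) f) := by
  rw [← diffOp_tau_tprod]; rfl

theorem evalDiffOp_prod_of_lt {m n : ℕ} (hmn : m < n) (f : Fin n → C) (hf : ∀ i, ε (f i) = 0)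
    (a : ⨂[ℂ]^m 𝔤) : evalDiffOp L ε (∏ i, f i) (TensorPower.toTensorAlgebra a) = 0 := by
  have : evalDiffOp L ε (∏ i, f i) ∘ₗ TensorPower.toTensorAlgebra (n := m) = 0 := by
    ext y
    simp only [LinearMap.compMultilinearMap_apply, LinearMap.comp_apply,
      TensorPower.toTensorAlgebra_tprod, evalDiffOp_tprod]
    rw [← one_mul (∏ i, f i), iterDer_mul_prod_of_lt L ε _ (by simpa using hmn) _ _ hf]
    rfl
  exact LinearMap.congr_fun this a

/-- On pure tensors the functional is the sum of `prodDual ξ` over all permutations of the factors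
(the reversal is absorbed by the sum); on a symmetric tensor all `n!` terms agree. -/
theorem evalDiffOp_prod_of_symm {n : ℕ} (ξ : Fin n → Module.Dual ℂ 𝔤) (f : Fin n → C)
    (hf : ∀ i, ε (f i) = 0) (hξ : ∀ i y, ε (L y (f i)) = ξ i y) (a : ⨂[ℂ]^n 𝔤)
    (ha : ∀ σ : Equiv.Perm (Fin n), PiTensorProduct.reindex ℂ (fun _ : Fin n => 𝔤) σ a = a) :
    evalDiffOp L ε (∏ i, f i) (TensorPower.toTensorAlgebra a) =
      (Fintype.card (Equiv.Perm (Fin n)) : ℂ) * prodDual ξ a := by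
  have : evalDiffOp L ε (∏ i, f i) ∘ₗ TensorPower.toTensorAlgebra (n := n) =
      ∑ σ : Equiv.Perm (Fin n), prodDual ξ ∘ₗ
        (PiTensorProduct.reindex ℂ (fun _ : Fin n => 𝔤) σ).toLinearMap := by
    ext y
    simp only [LinearMap.compMultilinearMap_apply, LinearMap.comp_apply,
      TensorPower.toTensorAlgebra_tprod, evalDiffOp_tprod, LinearMap.sum_apply,
      LinearEquiv.coe_coe, PiTensorProduct.reindex_tprod, prodDual_tprod]
    rw [← one_mul (∏ i, f i), iterDer_mul_prod L ε _ _ _ hf, map_one, one_mul,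
      ← Equiv.sum_comp (Equiv.mulRight Fin.revPerm)]
    refine Finset.sum_congr rfl fun σ _ => ?_
    refine (Finset.prod_congr rfl fun i _ => hξ _ _).trans ?_
    refine (Equiv.prod_comp Fin.revPerm (fun j => ξ (σ j) (y j))).trans ?_
    rw [← Equiv.prod_comp σ (fun i => ξ i (y (σ.symm i)))]
    exact Finset.prod_congr rfl fun i _ => by rw [Equiv.symm_apply_apply]
  rw [← LinearMap.comp_apply, this, LinearMap.sum_apply]
  simp [ha]

/-- The injectivity part of the Poincaré–Birkhoff–Witt theorem for a Lie algebra that acts by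
derivations on a commutative algebra with local coordinates at a point. -/
theorem tau_injOn_of_coordinates [FiniteDimensional ℂ 𝔤]
    (h : ∀ ξ : Module.Dual ℂ 𝔤, ∃ f : C, ε f = 0 ∧ ∀ y, ε (L y f) = ξ y) :
    Set.InjOn (τ 𝔤) (allSymTensors 𝔤 : Set (TensorAlgebra ℂ 𝔤)) := by
  have main : ∀ s ∈ allSymTensors 𝔤, τ 𝔤 s = 0 → s = 0 := by
    intro s hs hτ
    obtain ⟨F, hF, rfl⟩ := (Submodule.mem_iSup_iff_exists_finsupp _ _).1 hs
    suffices hF0 : F = 0 by rw [hF0, Finsupp.sum_zero_index]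
    by_contra hF0
    have hne := Finsupp.support_nonempty_iff.2 hF0
    -- In the top degree `n`, test against a product of `n` functions vanishing at the point:
    -- components of lower degree contribute nothing, and the top one is recovered through
    -- `prodDual`.
    set n := F.support.max' hne with hn
    have hnF : F n ≠ 0 := Finsupp.mem_support_iff.1 (Finset.max'_mem _ _)
    obtain ⟨a, ha, haF⟩ := hF n
    apply hnF
    rw [← haF]
    suffices ha0 : a = 0 by rw [ha0, map_zero]
    refine eq_zero_of_prodDual_eq_zero fun ξ => ?_
    choose f hf hfξ using fun i => h (ξ i)
    have h1 : evalDiffOp L ε (∏ i, f i) (F.sum fun _ x => x) = 0 := by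
      simp [evalDiffOp, hτ]
    rw [Finsupp.sum, map_sum, Finset.sum_eq_single n, ← haF,
      evalDiffOp_prod_of_symm L ε ξ f hf hfξ] at h1
    · exact (mul_eq_zero.1 h1).resolve_left (Nat.cast_ne_zero.2 Fintype.card_ne_zero)
    · intro σ
      exact (Submodule.mem_iInf _).1 ha σ
    · intro m hm hmn
      obtain ⟨b, -, hb⟩ := hF m
      rw [← hb]
      exact evalDiffOp_prod_of_lt L ε (lt_of_le_of_ne (Finset.le_max' _ _ hm) hmn) f hf b
    · intro hn'
      exact absurd (Finset.max'_mem _ hne) hn'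
  intro s hs t ht hst
  rw [← sub_eq_zero]
  exact main _ (Submodule.sub_mem _ hs ht) (by rw [map_sub, hst, sub_self])

end Injective

/-! ### Invariant vector fields and coordinates at the identity. -/

section Coordinates

variable {𝔤 : Type*} [LieRing 𝔤] [LieAlgebra ℂ 𝔤] [FiniteDimensional ℂ 𝔤]

/-- The matrix of `ad y` in a fixed basis. -/
noncomputable def adMatrix (y : 𝔤) :
    Matrix (Fin (Module.finrank ℂ 𝔤)) (Fin (Module.finrank ℂ 𝔤)) ℂ :=
  LinearMap.toMatrix (Module.finBasis ℂ 𝔤) (Module.finBasis ℂ 𝔤) (LieAlgebra.ad ℂ 𝔤 y)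

theorem adMatrix_lie (y z : 𝔤) :
    adMatrix ⁅y, z⁆ = adMatrix y * adMatrix z - adMatrix z * adMatrix y := by
  simp only [adMatrix, ← LinearMap.toMatrix_mul, ← map_sub]
  congr 1
  ext w
  simp

theorem killingForm_eq_sum (x y : 𝔤) :
    killingForm ℂ 𝔤 x y = ∑ i, ∑ j, adMatrix x j i * adMatrix y i j := by
  rw [killingForm_apply_apply, LinearMap.trace_eq_matrix_trace ℂ (Module.finBasis ℂ 𝔤),
    LinearMap.toMatrix_comp _ (Module.finBasis ℂ 𝔤), Matrix.trace, Finset.sum_comm]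
  rfl

/-- The polynomial functions on the product of the space of matrices with the space with a
coordinate for each `c ∈ 𝔤` that is `B`-orthogonal to `[𝔤, 𝔤]`. -/
abbrev CoordRing (B : LinearMap.BilinForm ℂ 𝔤) : Type _ :=
  MvPolynomial ((Fin (Module.finrank ℂ 𝔤) × Fin (Module.finrank ℂ 𝔤)) ⊕
    {c : 𝔤 // ∀ a b : 𝔤, B c ⁅a, b⁆ = 0}) ℂ

variable (B : LinearMap.BilinForm ℂ 𝔤)

/-- The left invariant vector field attached to `y`. -/
noncomputable def invariantField (y : 𝔤) : Derivation ℂ (CoordRing B) (CoordRing B) :=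
  MvPolynomial.mkDerivation ℂ (Sum.elim
    (fun p => ∑ k, MvPolynomial.C (adMatrix y k p.2) * MvPolynomial.X (Sum.inl (p.1, k)))
    (fun c => MvPolynomial.C (B c y)))

theorem invariantField_inl (y : 𝔤) (i j : Fin (Module.finrank ℂ 𝔤)) :
    invariantField B y (MvPolynomial.X (Sum.inl (i, j))) =
      ∑ k, MvPolynomial.C (adMatrix y k j) * MvPolynomial.X (Sum.inl (i, k)) := by
  simp [invariantField, MvPolynomial.mkDerivation_X]

theorem invariantField_inr (y : 𝔤) (c : {c : 𝔤 // ∀ a b : 𝔤, B c ⁅a, b⁆ = 0}) :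
    invariantField B y (MvPolynomial.X (Sum.inr c)) = MvPolynomial.C (B c y) := by
  simp [invariantField, MvPolynomial.mkDerivation_X]

/-- On the matrix `X` of coordinates the field of `y` is `X ↦ X · ad y`. Composition keeps the order
of the factors, so brackets go to commutators without a sign. -/
theorem invariantField_comp_inl (y z : 𝔤) (i j : Fin (Module.finrank ℂ 𝔤)) :
    invariantField B y (invariantField B z (MvPolynomial.X (Sum.inl (i, j)))) =
      ∑ k, MvPolynomial.C ((adMatrix y * adMatrix z) k j) * MvPolynomial.X (Sum.inl (i, k)) := by
  simp only [invariantField_inl, map_sum, Derivation.leibniz, MvPolynomial.derivation_C,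
    smul_eq_mul, mul_zero, add_zero, Finset.mul_sum, Matrix.mul_apply, Finset.sum_mul, map_mul]
  rw [Finset.sum_comm]
  refine Finset.sum_congr rfl fun k _ => Finset.sum_congr rfl fun l _ => ?_
  ring

/-- The left invariant vector fields, as a homomorphism of Lie algebras. -/
noncomputable def invariantFieldHom : 𝔤 →ₗ⁅ℂ⁆ Derivation ℂ (CoordRing B) (CoordRing B) where
  toFun := invariantField B
  map_add' y z := by
    refine MvPolynomial.derivation_ext ?_
    rintro (⟨i, j⟩ | c)
    · simp [invariantField_inl, adMatrix, add_mul, Finset.sum_add_distrib]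
    · simp [invariantField_inr]
  map_smul' r y := by
    refine MvPolynomial.derivation_ext ?_
    rintro (⟨i, j⟩ | c)
    · simp [invariantField_inl, adMatrix, Finset.smul_sum, MvPolynomial.smul_eq_C_mul, mul_assoc]
    · simp [invariantField_inr, MvPolynomial.smul_eq_C_mul]
  map_lie' {y z} := by
    refine MvPolynomial.derivation_ext ?_
    rintro (⟨i, j⟩ | c)
    · rw [Derivation.commutator_apply, invariantField_comp_inl, invariantField_comp_inl,
        invariantField_inl, adMatrix_lie, ← Finset.sum_sub_distrib]
      simp [sub_mul]
    -- On these coordinates the fields have constant values, so the commutator vanishes, in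
    -- agreement with `B c [y, z] = 0`.
    · rw [Derivation.commutator_apply]
      simp [invariantField_inr, c.2]

/-- Evaluation at the identity. -/
noncomputable def evalOne : CoordRing B →ₐ[ℂ] ℂ :=
  MvPolynomial.aeval (Sum.elim (fun p => if p.1 = p.2 then 1 else 0) fun _ => 0)

/-- At the identity the derivative of `X_ij` along `y` is `(ad y)_ij`, so `tr (ad x · X)` has
derivative `killingForm x y`. The extra coordinate of `c` supplies `B c y`, which `ad` alone cannot
see on the center. -/
theorem exists_coordinate [LieAlgebra.HasCentralRadical ℂ 𝔤] (hB_nondeg : B.Nondegenerate)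
    (hB_inv : B.lieInvariant 𝔤) (ξ : Module.Dual ℂ 𝔤) :
    ∃ f : CoordRing B, evalOne B f = 0 ∧ ∀ y, evalOne B (invariantFieldHom B y f) = ξ y := by
  obtain ⟨x, c, hc, hξ⟩ := exists_killingForm_add B hB_nondeg hB_inv ξ
  let f₀ : CoordRing B := ∑ i, ∑ j, MvPolynomial.C (adMatrix x j i) *
    MvPolynomial.X (Sum.inl (i, j)) + MvPolynomial.X (Sum.inr ⟨c, hc⟩)
  refine ⟨f₀ - MvPolynomial.C (evalOne B f₀), ?_, fun y => ?_⟩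
  · rw [map_sub, sub_eq_zero]
    simp [evalOne]
  · change evalOne B (invariantField B y _) = _
    rw [map_sub, MvPolynomial.derivation_C, sub_zero, hξ, killingForm_eq_sum]
    simp [f₀, invariantField_inl, invariantField_inr, evalOne]

end Coordinates

/-- The injectivity part of the Poincaré–Birkhoff–Witt theorem: `τ` is injective on the symmetric
tensors. -/
theorem tau_injOn_allSymTensors {𝔤 : Type*} [LieRing 𝔤] [LieAlgebra ℂ 𝔤] [FiniteDimensional ℂ 𝔤]
    [LieAlgebra.HasCentralRadical ℂ 𝔤] (B : LinearMap.BilinForm ℂ 𝔤) (hB_nondeg : B.Nondegenerate)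
    (hB_inv : B.lieInvariant 𝔤) :
    Set.InjOn (τ 𝔤) (allSymTensors 𝔤 : Set (TensorAlgebra ℂ 𝔤)) :=
  tau_injOn_of_coordinates (invariantFieldHom B) (evalOne B)
    (exists_coordinate B hB_nondeg hB_inv)

/-! ### Pfaffians of a bilinear form, and their vanishing in small rank. -/

section Pairing

/-- The partition of `2k` indices into `k` consecutive pairs. -/
def pairEquiv (k : ℕ) : Fin k × Fin 2 ≃ Fin (2 * k) :=
  finProdFinEquiv.trans (finCongr (mul_comm k 2))

variable {V N P : Type*} [AddCommGroup V] [Module ℂ V] [AddCommGroup N] [Module ℂ N]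
  [AddCommGroup P] [Module ℂ P] {k : ℕ}

theorem pair_update_zero [DecidableEq (Fin (2 * k))] (β : V →ₗ[ℂ] V →ₗ[ℂ] N)
    (v : Fin (2 * k) → V) (i : Fin k) (w : V) :
    (fun i' => β (Function.update v (pairEquiv k (i, 0)) w (pairEquiv k (i', 0)))
      (Function.update v (pairEquiv k (i, 0)) w (pairEquiv k (i', 1)))) =
    Function.update (fun i' => β (v (pairEquiv k (i', 0))) (v (pairEquiv k (i', 1)))) i
      (β w (v (pairEquiv k (i, 1)))) := by
  funext i'
  by_cases h : i' = i
  · subst h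
    simp
  · simp [h]

theorem pair_update_one [DecidableEq (Fin (2 * k))] (β : V →ₗ[ℂ] V →ₗ[ℂ] N)
    (v : Fin (2 * k) → V) (i : Fin k) (w : V) :
    (fun i' => β (Function.update v (pairEquiv k (i, 1)) w (pairEquiv k (i', 0)))
      (Function.update v (pairEquiv k (i, 1)) w (pairEquiv k (i', 1)))) =
    Function.update (fun i' => β (v (pairEquiv k (i', 0))) (v (pairEquiv k (i', 1)))) i
      (β (v (pairEquiv k (i, 0))) w) := by
  funext i'
  by_cases h : i' = i
  · subst h
    simp
  · simp [h]

/-- The multilinear map `v ↦ f (β v₀ v₁, β v₂ v₃, …)`. -/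
def pairMulti (β : V →ₗ[ℂ] V →ₗ[ℂ] N) (f : MultilinearMap ℂ (fun _ : Fin k => N) P) :
    MultilinearMap ℂ (fun _ : Fin (2 * k) => V) P where
  toFun v := f fun i => β (v (pairEquiv k (i, 0))) (v (pairEquiv k (i, 1)))
  map_update_add' v j x y := by
    obtain ⟨⟨i, a⟩, rfl⟩ := (pairEquiv k).surjective j
    fin_cases a
    · simp only [Fin.zero_eta, pair_update_zero, map_add, LinearMap.add_apply,
        MultilinearMap.map_update_add]
    · simp only [Fin.mk_one, pair_update_one, map_add, MultilinearMap.map_update_add]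
  map_update_smul' v j c x := by
    obtain ⟨⟨i, a⟩, rfl⟩ := (pairEquiv k).surjective j
    fin_cases a
    · simp only [Fin.zero_eta, pair_update_zero, map_smul, LinearMap.smul_apply,
        MultilinearMap.map_update_smul]
    · simp only [Fin.mk_one, pair_update_one, map_smul, MultilinearMap.map_update_smul]

/-- The unnormalized Pfaffians of a bilinear form: the alternatization of
`v ↦ ω(v₀, v₁) ω(v₂, v₃) ⋯`. -/
noncomputable def pfaffian (ω : LinearMap.BilinForm ℂ V) (k : ℕ) : V [⋀^Fin (2 * k)]→ₗ[ℂ] ℂ :=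
  MultilinearMap.alternatization (pairMulti ω (MultilinearMap.mkPiAlgebra ℂ (Fin k) ℂ))

theorem pfaffian_apply (ω : LinearMap.BilinForm ℂ V) (v : Fin (2 * k) → V) :
    pfaffian ω k v = ∑ σ : Equiv.Perm (Fin (2 * k)), Equiv.Perm.sign σ •
      ∏ i : Fin k, ω (v (σ (pairEquiv k (i, 0)))) (v (σ (pairEquiv k (i, 1)))) := by
  rw [pfaffian, MultilinearMap.alternatization_apply]
  rfl

/-- The value depends on each `v i` only through `ω (v i)`, so `v i` may be replaced by a lift of `ω
(v i)` under a linear section. The lifts lie in a space of dimension `rank ω < 2k`, hence are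
dependent. -/
theorem pfaffian_eq_zero_of_rank_lt [FiniteDimensional ℂ V] (ω : LinearMap.BilinForm ℂ V)
    (hω : ω.IsAlt) (h : Module.finrank ℂ (LinearMap.range ω) < 2 * k) : pfaffian ω k = 0 := by
  obtain ⟨g, hg⟩ := LinearMap.exists_rightInverse_of_surjective ω.rangeRestrict
    (LinearMap.range_rangeRestrict _)
  have hg' : ∀ v, ω (g (ω.rangeRestrict v)) = ω v := fun v =>
    congrArg Subtype.val (LinearMap.congr_fun hg (ω.rangeRestrict v))
  ext v
  have h1 : pfaffian ω k v = pfaffian ω k fun i => g (ω.rangeRestrict (v i)) := by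
    rw [pfaffian_apply, pfaffian_apply]
    refine Finset.sum_congr rfl fun σ _ => ?_
    congr 1
    refine Finset.prod_congr rfl fun i _ => ?_
    rw [hg', ← hω.neg_eq (g _) (v _), hg', hω.neg_eq]
  rw [h1, AlternatingMap.zero_apply]
  apply AlternatingMap.map_linearDependent
  intro hli
  have h2 : LinearIndependent ℂ fun i => ω.rangeRestrict (v i) := LinearIndependent.of_comp g hli
  have := h2.fintype_card_le_finrank
  rw [Fintype.card_fin] at this
  omega

end Pairing

/-! ### Symplectic families, evenness of the rank, and nonvanishing of Pfaffians. -/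

section Symplectic

/-- The Gram matrix of a symplectic basis. -/
def sympForm {ι : Type*} [DecidableEq ι] (p q : ι × Fin 2) : ℤ :=
  if p.1 = q.1 then (q.2 : ℤ) - (p.2 : ℤ) else 0

theorem sign_mul_sub_fin_two :
    ∀ δ : Equiv.Perm (Fin 2), (Equiv.Perm.sign δ : ℤ) * ((δ 1 : ℤ) - (δ 0 : ℤ)) = 1 := by
  decide

/-- A term is nonzero only if `σ` maps pairs to pairs, and then it equals `1`. Hence the terms of
the Pfaffian of the standard form cannot cancel. -/
theorem sign_mul_prod_sympForm_nonneg {k : ℕ} (σ : Equiv.Perm (Fin k × Fin 2)) :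
    0 ≤ (Equiv.Perm.sign σ : ℤ) * ∏ i, sympForm (σ (i, 0)) (σ (i, 1)) := by
  by_cases h : ∀ i, (σ (i, 0)).1 = (σ (i, 1)).1
  · have h1 : ∀ i a, (σ (i, a)).1 = (σ (i, 0)).1 := fun i a => by
      fin_cases a
      · rfl
      · exact (h i).symm
    have hδ : ∀ i, Function.Bijective fun a => (σ (i, a)).2 := fun i => by
      rw [← Finite.injective_iff_bijective]
      intro a b hab
      have : σ (i, a) = σ (i, b) := Prod.ext ((h1 i a).trans (h1 i b).symm) hab
      exact congrArg Prod.snd (σ.injective this)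
    let δ : Fin k → Equiv.Perm (Fin 2) := fun i => Equiv.ofBijective _ (hδ i)
    have hπ : Function.Bijective fun i => (σ (i, 0)).1 := by
      rw [← Finite.injective_iff_bijective]
      intro i j hij
      obtain ⟨a, ha⟩ := (hδ i).2 (σ (j, 0)).2
      have : σ (i, a) = σ (j, 0) := Prod.ext ((h1 i a).trans hij) ha
      exact congrArg Prod.fst (σ.injective this)
    let π : Equiv.Perm (Fin k) := Equiv.ofBijective _ hπ
    -- The permutation `π` of the pairs acts on two copies of `Fin k`, so its sign is squared away;
    -- the signs of the flips `δ i` cancel those of `sympForm`.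
    have hσ : σ = Equiv.prodCongrLeft (fun _ : Fin 2 => π) * Equiv.prodCongrRight δ := by
      ext1 ⟨i, a⟩
      exact Prod.ext (h1 i a) rfl
    have hsign : (Equiv.Perm.sign σ : ℤ) = ∏ i, (Equiv.Perm.sign (δ i) : ℤ) := by
      rw [hσ, Equiv.Perm.sign_mul, Equiv.Perm.sign_prodCongrLeft, Equiv.Perm.sign_prodCongrRight]
      simp
    rw [hsign, ← Finset.prod_mul_distrib, Finset.prod_eq_one]
    · exact zero_le_one
    · intro i _
      rw [sympForm, if_pos (h i)]
      exact sign_mul_sub_fin_two (δ i)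
  · push Not at h
    obtain ⟨i, hi⟩ := h
    rw [Finset.prod_eq_zero (Finset.mem_univ i) (by rw [sympForm, if_neg hi]), mul_zero]

theorem sum_sign_mul_prod_sympForm_pos (k : ℕ) :
    0 < ∑ σ : Equiv.Perm (Fin k × Fin 2),
      (Equiv.Perm.sign σ : ℤ) * ∏ i, sympForm (σ (i, 0)) (σ (i, 1)) := by
  refine Finset.sum_pos' (fun σ _ => sign_mul_prod_sympForm_nonneg σ) ⟨1, Finset.mem_univ _, ?_⟩
  simp [sympForm]

variable {V : Type*} [AddCommGroup V] [Module ℂ V]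

theorem pfaffian_ne_zero_of_symplectic (ω : LinearMap.BilinForm ℂ V) {k : ℕ}
    (b : Fin k × Fin 2 → V) (hb : ∀ p q, ω (b p) (b q) = sympForm p q) : pfaffian ω k ≠ 0 := by
  intro h
  have h1 := congrArg (fun f => f (b ∘ (pairEquiv k).symm)) h
  simp only [AlternatingMap.zero_apply] at h1
  rw [pfaffian_apply, ← Equiv.sum_comp (pairEquiv k).permCongr] at h1
  have h2 : ∑ σ : Equiv.Perm (Fin k × Fin 2),
      (Equiv.Perm.sign σ : ℤ) * ∏ i, sympForm (σ (i, 0)) (σ (i, 1)) = 0 := by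
    rw [← Int.cast_inj (α := ℂ), Int.cast_zero, ← h1, Int.cast_sum]
    refine Finset.sum_congr rfl fun σ _ => ?_
    simp [Equiv.permCongr_apply, hb, Units.smul_def]
  exact (sum_sign_mul_prod_sympForm_pos k).ne' h2

theorem linearIndependent_of_symplectic (ω : LinearMap.BilinForm ℂ V) {r : ℕ}
    (b : Fin r × Fin 2 → V) (hb : ∀ p q, ω (b p) (b q) = sympForm p q) :
    LinearIndependent ℂ fun p => ω (b p) := by
  rw [Fintype.linearIndependent_iff]
  intro c hc
  have h : ∀ q, ∑ p, c p * sympForm p q = 0 := fun q => by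
    have := LinearMap.congr_fun hc (b q)
    simpa [LinearMap.sum_apply, hb] using this
  rintro ⟨i, a⟩
  fin_cases a
  · simpa [sympForm, Fintype.sum_prod_type, Finset.sum_add_distrib] using h (i, 1)
  · simpa [sympForm, Fintype.sum_prod_type, Finset.sum_add_distrib] using h (i, 0)

/-- An alternating form has a symplectic family that spans its range; in particular, its rank is
even. -/
theorem exists_symplectic [FiniteDimensional ℂ V] (ω : LinearMap.BilinForm ℂ V) (hω : ω.IsAlt) :
    ∃ (r : ℕ) (b : Fin r × Fin 2 → V), (∀ p q, ω (b p) (b q) = sympForm p q) ∧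
      Module.finrank ℂ (LinearMap.range ω) = 2 * r := by
  let S : Set ℕ := {r | ∃ b : Fin r × Fin 2 → V, ∀ p q, ω (b p) (b q) = sympForm p q}
  have hS0 : S.Nonempty := ⟨0, fun p => p.1.elim0, fun p => p.1.elim0⟩
  have hSb : BddAbove S := by
    refine ⟨Module.finrank ℂ (V →ₗ[ℂ] ℂ), ?_⟩
    rintro r ⟨b, hb⟩
    have := (linearIndependent_of_symplectic ω b hb).fintype_card_le_finrank
    rw [Fintype.card_prod, Fintype.card_fin, Fintype.card_fin] at this
    omega
  obtain ⟨b, hb⟩ := Nat.sSup_mem hS0 hSb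
  generalize hr : sSup S = r at b hb
  refine ⟨r, b, hb, ?_⟩
  -- Maximality of `r`: two vectors orthogonal to the family with `ω w w' ≠ 0` would, after
  -- rescaling, extend it by one pair.
  have hW : ∀ w w', (∀ p, ω (b p) w = 0) → (∀ p, ω (b p) w' = 0) → ω w w' = 0 := by
    intro w w' hw hw'
    by_contra hne
    have hw2 : ∀ p, ω w (b p) = 0 := fun p => by rw [← hω.neg_eq, hw, neg_zero]
    have hw2' : ∀ p, ω w' (b p) = 0 := fun p => by rw [← hω.neg_eq, hw', neg_zero]
    have hmem : r + 1 ∈ S := by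
      refine ⟨fun p => Fin.cases (![w, (ω w w')⁻¹ • w'] p.2) (fun i => b (i, p.2)) p.1, ?_⟩
      rintro ⟨i, a⟩ ⟨j, c⟩
      refine Fin.cases ?_ (fun i => ?_) i <;> refine Fin.cases ?_ (fun j => ?_) j
      · have : ω w' w = - ω w w' := (hω.neg_eq _ _).symm
        fin_cases a <;> fin_cases c <;> simp [sympForm, hω.self_eq_zero, this, hne]
      · fin_cases a <;> simp [sympForm, hw2, hw2', (Fin.succ_ne_zero _).symm]
      · fin_cases c <;> simp [sympForm, hw, hw', Fin.succ_ne_zero]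
      · simp [sympForm, hb]
    have := le_csSup hSb hmem
    omega
  -- Projection onto the orthogonal complement of the family. By maximality its image lies in the
  -- kernel of `ω`, so the `ω (b p)` span the range.
  let pr : V → V := fun v => v - ∑ i, (ω v (b (i, 1)) • b (i, 0) - ω v (b (i, 0)) • b (i, 1))
  have hpr : ∀ v p, ω (b p) (pr v) = 0 := by
    rintro v ⟨j, a⟩
    have h0 : ω (b (j, 0)) v = - ω v (b (j, 0)) := (hω.neg_eq _ _).symm
    have h1 : ω (b (j, 1)) v = - ω v (b (j, 1)) := (hω.neg_eq _ _).symm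
    fin_cases a <;> simp [pr, hb, sympForm, h0, h1, Finset.sum_sub_distrib]
  have hpr0 : ∀ v, ω (pr v) = 0 := by
    intro v
    ext w
    have hw : w = pr w + ∑ i, (ω w (b (i, 1)) • b (i, 0) - ω w (b (i, 0)) • b (i, 1)) := by
      simp [pr]
    have h0 : ∀ p, ω (pr v) (b p) = 0 := fun p => by rw [← hω.neg_eq, hpr, neg_zero]
    rw [hw, map_add, hW _ _ (hpr v) (hpr w)]
    simp [h0]
  have hrange : LinearMap.range ω = Submodule.span ℂ (Set.range fun p => ω (b p)) := by
    apply le_antisymm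
    · rintro _ ⟨v, rfl⟩
      have hv : v = pr v + ∑ i, (ω v (b (i, 1)) • b (i, 0) - ω v (b (i, 0)) • b (i, 1)) := by
        simp [pr]
      rw [hv, map_add, hpr0, zero_add, map_sum]
      refine Submodule.sum_mem _ fun i _ => ?_
      rw [map_sub, map_smul, map_smul]
      exact Submodule.sub_mem _
        (Submodule.smul_mem _ _ (Submodule.subset_span ⟨_, rfl⟩))
        (Submodule.smul_mem _ _ (Submodule.subset_span ⟨_, rfl⟩))
    · rw [Submodule.span_le]
      rintro _ ⟨p, rfl⟩
      exact LinearMap.mem_range_self _ _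
  rw [hrange, finrank_span_eq_card (linearIndependent_of_symplectic ω b hb), Fintype.card_prod,
    Fintype.card_fin, Fintype.card_fin, mul_comm]

theorem even_rank_of_isAlt [FiniteDimensional ℂ V] {ω : LinearMap.BilinForm ℂ V} (hω : ω.IsAlt) :
    Even (Module.finrank ℂ (LinearMap.range ω)) := by
  obtain ⟨r, _, _, h⟩ := exists_symplectic ω hω
  exact ⟨r, by omega⟩

theorem pfaffian_eq_zero_iff [FiniteDimensional ℂ V] {ω : LinearMap.BilinForm ℂ V} (hω : ω.IsAlt)
    (k : ℕ) : pfaffian ω k = 0 ↔ Module.finrank ℂ (LinearMap.range ω) < 2 * k := by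
  refine ⟨fun h => ?_, pfaffian_eq_zero_of_rank_lt ω hω⟩
  by_contra hlt
  obtain ⟨r, b, hb, hr⟩ := exists_symplectic ω hω
  have hkr : k ≤ r := by omega
  refine pfaffian_ne_zero_of_symplectic ω (fun p => b (Fin.castLE hkr p.1, p.2)) (fun p q => ?_) h
  rw [hb]
  simp [sympForm]

end Symplectic

/-! ### Alternating tensors and the exterior algebra. -/

open MultilinearMap (alternatization)

theorem toTensorAlgebra_alternatization {𝔤 V : Type*} [AddCommGroup 𝔤] [Module ℂ 𝔤]
    [AddCommGroup V] [Module ℂ V] {m n : ℕ}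
    (f : MultilinearMap ℂ (fun _ : Fin m => V) (⨂[ℂ]^n 𝔤)) (v : Fin m → V) :
    TensorPower.toTensorAlgebra (alternatization f v) =
      alternatization (TensorPower.toTensorAlgebra.compMultilinearMap f) v := by
  rw [LinearMap.compMultilinearMap_alternatization]
  rfl

section Alternating

variable {𝔤 : Type*} [LieRing 𝔤] [LieAlgebra ℂ 𝔤]

theorem toTensorAlgebra_comp_tprod (n : ℕ) :
    TensorPower.toTensorAlgebra.compMultilinearMap (PiTensorProduct.tprod ℂ) =
      TensorAlgebra.tprod ℂ 𝔤 n := by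
  ext v
  exact TensorPower.toTensorAlgebra_tprod v

theorem alternatization_tprod_mem_altTensors {n : ℕ} (v : Fin n → 𝔤) :
    alternatization (TensorAlgebra.tprod ℂ 𝔤 n) v ∈ altTensors 𝔤 n := by
  rw [← toTensorAlgebra_comp_tprod, ← toTensorAlgebra_alternatization]
  refine Submodule.mem_map_of_mem ((Submodule.mem_iInf _).2 fun π => ?_)
  rw [LinearMap.mem_eqLocus]
  change PiTensorProduct.reindex ℂ (fun _ : Fin n => 𝔤) π _ =
    ((Equiv.Perm.sign π : ℤˣ) : ℤ) • alternatization (PiTensorProduct.tprod ℂ) v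
  rw [MultilinearMap.alternatization_apply, map_sum]
  refine Eq.trans ?_ (map_sum (zsmulAddGroupHom (α := ⨂[ℂ]^n 𝔤) ((Equiv.Perm.sign π : ℤˣ) : ℤ)) _ _).symm
  rw [← Equiv.sum_comp (Equiv.mulRight π)]
  refine Finset.sum_congr rfl fun σ _ => ?_
  simp only [Units.smul_def, map_zsmul, MultilinearMap.domDomCongr_apply,
    PiTensorProduct.reindex_tprod, Equiv.coe_mulRight, Equiv.Perm.sign_mul, Units.val_mul,
    zsmulAddGroupHom_apply]
  refine Eq.trans ?_ (mul_zsmul _ _ _)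
  congr 2
  funext i
  simp

/-- The antisymmetrizer `A` multiplies alternating tensors by `n!` and sends pure tensors to
alternatizations; pure tensors span. -/
theorem altTensors_le_span (n : ℕ) :
    altTensors 𝔤 n ≤ Submodule.span ℂ (Set.range (alternatization (TensorAlgebra.tprod ℂ 𝔤 n))) := by
  rintro _ ⟨a, ha, rfl⟩
  let A : (⨂[ℂ]^n 𝔤) →ₗ[ℂ] TensorAlgebra ℂ 𝔤 := ∑ σ : Equiv.Perm (Fin n),
    ((Equiv.Perm.sign σ : ℤˣ) : ℤ) • (TensorPower.toTensorAlgebra ∘ₗ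
      (PiTensorProduct.reindex ℂ (fun _ : Fin n => 𝔤) σ).toLinearMap)
  have hA : A a = (n.factorial : ℂ) • TensorPower.toTensorAlgebra a := by
    have : ∀ σ : Equiv.Perm (Fin n), ((Equiv.Perm.sign σ : ℤˣ) : ℤ) •
        TensorPower.toTensorAlgebra (PiTensorProduct.reindex ℂ (fun _ : Fin n => 𝔤) σ a) =
        TensorPower.toTensorAlgebra a := fun σ => by
      have h := (Submodule.mem_iInf _).1 ha σ
      rw [LinearMap.mem_eqLocus] at h
      change PiTensorProduct.reindex ℂ (fun _ : Fin n => 𝔤) σ a =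
        ((Equiv.Perm.sign σ : ℤˣ) : ℤ) • a at h
      rw [h, map_zsmul, smul_smul, ← Units.val_mul, Int.units_mul_self, Units.val_one, one_smul]
    simp only [A, LinearMap.sum_apply, LinearMap.smul_apply, LinearMap.comp_apply,
      LinearEquiv.coe_coe, this, Finset.sum_const, Finset.card_univ, Fintype.card_perm,
      Fintype.card_fin, Nat.cast_smul_eq_nsmul]
  have hmem : ∀ b, A b ∈
      Submodule.span ℂ (Set.range (alternatization (TensorAlgebra.tprod ℂ 𝔤 n))) := by
    intro b
    have hb : b ∈ Submodule.span ℂ (Set.range (PiTensorProduct.tprod ℂ)) := by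
      rw [PiTensorProduct.span_tprod_eq_top]; trivial
    refine (Submodule.map_span_le A _ _).2 ?_ (Submodule.mem_map_of_mem hb)
    rintro _ ⟨v, rfl⟩
    refine Submodule.subset_span ⟨v, ?_⟩
    rw [MultilinearMap.alternatization_apply, ← Equiv.sum_comp (Equiv.inv _)]
    simp only [A, LinearMap.sum_apply, LinearMap.smul_apply, LinearMap.comp_apply,
      LinearEquiv.coe_coe]
    refine Finset.sum_congr rfl fun σ _ => ?_
    rw [PiTensorProduct.reindex_tprod, TensorPower.toTensorAlgebra_tprod, Units.smul_def,
      Equiv.inv_apply, Equiv.Perm.sign_inv]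
    rfl
  have hn : (n.factorial : ℂ) ≠ 0 := Nat.cast_ne_zero.2 n.factorial_ne_zero
  rw [← Submodule.smul_mem_iff _ hn, ← hA]
  exact hmem a

theorem tauA_alternatization_tprod {n : ℕ} (v : Fin n → 𝔤) :
    τA 𝔤 (alternatization (TensorAlgebra.tprod ℂ 𝔤 n) v) =
      (n.factorial : ℂ) • ExteriorAlgebra.ιMulti ℂ n v := by
  have h : (τA 𝔤).toLinearMap.compMultilinearMap (TensorAlgebra.tprod ℂ 𝔤 n) =
      (ExteriorAlgebra.ιMulti ℂ n : 𝔤 [⋀^Fin n]→ₗ[ℂ] ExteriorAlgebra ℂ 𝔤) := by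
    ext w
    change τA 𝔤 _ = _
    rw [TensorAlgebra.tprod_apply, map_list_prod, List.map_ofFn]
    simp only [AlternatingMap.coe_multilinearMap, ExteriorAlgebra.ιMulti_apply]
    congr 2
    funext i
    exact TensorAlgebra.toExterior_ι (w i)
  have h2 := congrArg (fun f => alternatization f v) h
  simp only [LinearMap.compMultilinearMap_alternatization, AlternatingMap.coe_alternatization] at h2
  rw [← Nat.cast_smul_eq_nsmul ℂ, Fintype.card_fin] at h2
  exact h2

/-- Only surjectivity of `τ_A` is needed: the values of `Γ` turn out to depend on the lift `t` only
through `τ_A t`. -/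
theorem exists_mem_altTensors {n : ℕ} {u : ExteriorAlgebra ℂ 𝔤} (hu : u ∈ ⋀[ℂ]^n 𝔤) :
    ∃ t ∈ altTensors 𝔤 n, τA 𝔤 t = u := by
  suffices h : ⋀[ℂ]^n 𝔤 ≤ (altTensors 𝔤 n).map (τA 𝔤).toLinearMap from h hu
  rw [← exteriorPower.ιMulti_span_fixedDegree, Submodule.span_le]
  rintro _ ⟨v, rfl⟩
  have hn : (n.factorial : ℂ) ≠ 0 := Nat.cast_ne_zero.2 n.factorial_ne_zero
  rw [SetLike.mem_coe, ← Submodule.smul_mem_iff _ hn, ← tauA_alternatization_tprod]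
  exact Submodule.mem_map_of_mem (f := (τA 𝔤).toLinearMap) (alternatization_tprod_mem_altTensors v)

end Alternating

/-! ### The symmetric tensor built from brackets, and its image in `U(𝔤)`. -/

section Symmetric

attribute [local instance] LieRing.ofAssociativeRing

variable {𝔤 : Type*} [LieRing 𝔤] [LieAlgebra ℂ 𝔤]

/-- The alternating sum of the tensors `[v₀, v₁] ⊗ [v₂, v₃] ⊗ ⋯` over all orderings. -/
noncomputable def bracketTensor (k : ℕ) : 𝔤 [⋀^Fin (2 * k)]→ₗ[ℂ] TensorAlgebra ℂ 𝔤 :=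
  alternatization (pairMulti (LieAlgebra.ad ℂ 𝔤 : 𝔤 →ₗ[ℂ] 𝔤 →ₗ[ℂ] 𝔤) (TensorAlgebra.tprod ℂ 𝔤 k))

theorem sign_permCongr_prodCongrLeft {k : ℕ} (π : Equiv.Perm (Fin k)) :
    Equiv.Perm.sign ((pairEquiv k).permCongr (Equiv.prodCongrLeft fun _ : Fin 2 => π)) = 1 := by
  rw [Equiv.Perm.sign_permCongr, Equiv.Perm.sign_prodCongrLeft]
  simp

/-- Permuting the `k` tensor factors amounts to permuting pairs of arguments as blocks. That is an
even permutation, so it only reorders the alternating sum. -/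
theorem bracketTensor_mem_symTensors {k : ℕ} (v : Fin (2 * k) → 𝔤) :
    bracketTensor k v ∈ symTensors 𝔤 k := by
  have h : bracketTensor k v = TensorPower.toTensorAlgebra
      (alternatization (pairMulti (LieAlgebra.ad ℂ 𝔤 : 𝔤 →ₗ[ℂ] 𝔤 →ₗ[ℂ] 𝔤)
        (PiTensorProduct.tprod ℂ)) v) := by
    rw [toTensorAlgebra_alternatization, bracketTensor]
    congr 2
    ext w
    exact (TensorPower.toTensorAlgebra_tprod _).symm
  rw [h]
  refine Submodule.mem_map_of_mem ((Submodule.mem_iInf _).2 fun π => ?_)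
  rw [LinearMap.mem_eqLocus, LinearMap.id_apply, MultilinearMap.alternatization_apply, map_sum]
  conv_rhs => rw [← Equiv.sum_comp (Equiv.mulRight
    ((pairEquiv k).permCongr (Equiv.prodCongrLeft fun _ : Fin 2 => π⁻¹)))]
  refine Finset.sum_congr rfl fun σ _ => ?_
  rw [Equiv.coe_mulRight, Equiv.Perm.sign_mul, sign_permCongr_prodCongrLeft, mul_one,
    Units.smul_def, map_zsmul]
  congr 1
  refine (PiTensorProduct.reindex_tprod _ _).trans (congrArg (PiTensorProduct.tprod ℂ) ?_)
  funext i
  simp [Equiv.permCongr_apply]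

theorem tau_tprod_pair {k : ℕ} (w : Fin (2 * k) → 𝔤) :
    τ 𝔤 (TensorAlgebra.tprod ℂ 𝔤 (2 * k) w) =
      MultilinearMap.mkPiAlgebraFin ℂ k (UniversalEnvelopingAlgebra ℂ 𝔤) fun i =>
        UniversalEnvelopingAlgebra.ι ℂ (w (pairEquiv k (i, 0))) *
          UniversalEnvelopingAlgebra.ι ℂ (w (pairEquiv k (i, 1))) := by
  rw [TensorAlgebra.tprod_apply, List.ofFn_mul', List.prod_flatten, List.map_ofFn,
    map_list_prod, List.map_ofFn, MultilinearMap.mkPiAlgebraFin_apply]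
  congr 2
  funext i
  simp only [Function.comp_apply, List.ofFn_succ, List.ofFn_zero, List.prod_cons, List.prod_nil,
    mul_one, map_mul, UniversalEnvelopingAlgebra.ι_apply]
  congr 4 <;> ext <;> simp [pairEquiv, add_comm]

/-- Each bracket expands in `U(𝔤)` as `ab - ba`, a signed sum over `Perm (Fin 2)`; multiplying out
gives one term for each choice of flips. -/
theorem tau_tprod_ad {k : ℕ} (w : Fin (2 * k) → 𝔤) :
    τ 𝔤 (pairMulti (LieAlgebra.ad ℂ 𝔤 : 𝔤 →ₗ[ℂ] 𝔤 →ₗ[ℂ] 𝔤) (TensorAlgebra.tprod ℂ 𝔤 k) w) =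
      ∑ r : Fin k → Equiv.Perm (Fin 2), Equiv.Perm.sign
        ((pairEquiv k).permCongr (Equiv.prodCongrRight r)) •
          τ 𝔤 (TensorAlgebra.tprod ℂ 𝔤 (2 * k)
            (w ∘ (pairEquiv k).permCongr (Equiv.prodCongrRight r))) := by
  have h1 : τ 𝔤 (pairMulti (LieAlgebra.ad ℂ 𝔤 : 𝔤 →ₗ[ℂ] 𝔤 →ₗ[ℂ] 𝔤) (TensorAlgebra.tprod ℂ 𝔤 k) w) =
      MultilinearMap.mkPiAlgebraFin ℂ k (UniversalEnvelopingAlgebra ℂ 𝔤) fun i =>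
        UniversalEnvelopingAlgebra.ι ℂ ⁅w (pairEquiv k (i, 0)), w (pairEquiv k (i, 1))⁆ := by
    change τ 𝔤 (TensorAlgebra.tprod ℂ 𝔤 k _) = _
    rw [TensorAlgebra.tprod_apply, map_list_prod, List.map_ofFn,
      MultilinearMap.mkPiAlgebraFin_apply]
    rfl
  have h2 : ∀ i : Fin k,
      UniversalEnvelopingAlgebra.ι ℂ ⁅w (pairEquiv k (i, 0)), w (pairEquiv k (i, 1))⁆ =
      ∑ δ : Equiv.Perm (Fin 2), ((Equiv.Perm.sign δ : ℤ) : ℂ) •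
        (UniversalEnvelopingAlgebra.ι ℂ (w (pairEquiv k (i, δ 0))) *
          UniversalEnvelopingAlgebra.ι ℂ (w (pairEquiv k (i, δ 1)))) := by
    intro i
    have huniv : (Finset.univ : Finset (Equiv.Perm (Fin 2))) = {1, Equiv.swap 0 1} := by decide
    rw [huniv, Finset.sum_pair (by decide), LieHom.map_lie,
      LieRing.of_associative_ring_bracket, Equiv.Perm.sign_one, Equiv.Perm.sign_swap (by decide),
      Equiv.swap_apply_left, Equiv.swap_apply_right]
    simp [sub_eq_add_neg]
  rw [h1, funext h2, MultilinearMap.map_sum]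
  refine Finset.sum_congr rfl fun r _ => ?_
  rw [MultilinearMap.map_smul_univ, tau_tprod_pair, Equiv.Perm.sign_permCongr,
    Equiv.Perm.sign_prodCongrRight, Units.smul_def, ← Int.cast_smul_eq_zsmul ℂ]
  simp [Equiv.permCongr_apply]

/-- Every choice of flips inside the pairs is absorbed, with its sign, by the sum over all
orderings. The `2ᵏ` choices therefore contribute equally. -/
theorem tau_bracketTensor {k : ℕ} (v : Fin (2 * k) → 𝔤) :
    τ 𝔤 (bracketTensor k v) =
      (2 : ℂ) ^ k • τ 𝔤 (alternatization (TensorAlgebra.tprod ℂ 𝔤 (2 * k)) v) := by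
  simp only [bracketTensor, MultilinearMap.alternatization_apply, map_sum, Units.smul_def,
    map_zsmul]
  simp only [MultilinearMap.domDomCongr_apply, tau_tprod_ad, Finset.smul_sum]
  rw [Finset.sum_comm]
  have : ∀ r : Fin k → Equiv.Perm (Fin 2), ∑ σ : Equiv.Perm (Fin (2 * k)),
      (Equiv.Perm.sign σ : ℤ) • Equiv.Perm.sign
        ((pairEquiv k).permCongr (Equiv.prodCongrRight r)) •
          τ 𝔤 (TensorAlgebra.tprod ℂ 𝔤 (2 * k)
            ((fun i => v (σ i)) ∘ (pairEquiv k).permCongr (Equiv.prodCongrRight r))) =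
      ∑ σ : Equiv.Perm (Fin (2 * k)), (Equiv.Perm.sign σ : ℤ) •
        τ 𝔤 (TensorAlgebra.tprod ℂ 𝔤 (2 * k) fun i => v (σ i)) := by
    intro r
    rw [← Equiv.sum_comp (Equiv.mulRight ((pairEquiv k).permCongr (Equiv.prodCongrRight r)))
      fun σ => (Equiv.Perm.sign σ : ℤ) • τ 𝔤 (TensorAlgebra.tprod ℂ 𝔤 (2 * k) fun i => v (σ i))]
    refine Finset.sum_congr rfl fun σ _ => ?_
    rw [Equiv.coe_mulRight, Equiv.Perm.sign_mul, Units.val_mul, mul_smul]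
    rfl
  simp only [this, Finset.sum_const, Finset.card_univ]
  rw [← Finset.smul_sum, ← Nat.cast_smul_eq_nsmul ℂ]
  congr 1
  simp [Fintype.card_perm]

end Symmetric

/-! ### Values of `Γ` as Pfaffians of the Kirillov form. -/

section Gamma

variable {𝔤 : Type*} [LieRing 𝔤] [LieAlgebra ℂ 𝔤] (B : LinearMap.BilinForm ℂ 𝔤) (x : 𝔤)

/-- The alternating form `(y, z) ↦ B([y, z], x)`. -/
noncomputable def kirillovForm : LinearMap.BilinForm ℂ 𝔤 :=
  (LieAlgebra.ad ℂ 𝔤 : 𝔤 →ₗ[ℂ] 𝔤 →ₗ[ℂ] 𝔤).compr₂ (B.flip x)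

theorem kirillovForm_apply (y z : 𝔤) : kirillovForm B x y z = B ⁅y, z⁆ x := rfl

theorem kirillovForm_isAlt : (kirillovForm B x).IsAlt := fun y => by
  rw [kirillovForm_apply, lie_self, map_zero, LinearMap.zero_apply]

theorem evalAt_bracketTensor {k : ℕ} (v : Fin (2 * k) → 𝔤) :
    evalAt B x (τS 𝔤 (bracketTensor k v)) = pfaffian (kirillovForm B x) k v := by
  have h : (((evalAt B x).comp (τS 𝔤)).toLinearMap).compMultilinearMap
      (pairMulti (LieAlgebra.ad ℂ 𝔤 : 𝔤 →ₗ[ℂ] 𝔤 →ₗ[ℂ] 𝔤) (TensorAlgebra.tprod ℂ 𝔤 k)) =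
      pairMulti (kirillovForm B x) (MultilinearMap.mkPiAlgebra ℂ (Fin k) ℂ) := by
    ext w
    change (evalAt B x).comp (τS 𝔤) (TensorAlgebra.tprod ℂ 𝔤 k _) =
      ∏ i, kirillovForm B x (w (pairEquiv k (i, 0))) (w (pairEquiv k (i, 1)))
    rw [TensorAlgebra.tprod_apply, map_list_prod, List.map_ofFn, List.prod_ofFn]
    refine Finset.prod_congr rfl fun i _ => ?_
    exact SymmetricAlgebra.lift_ι_apply (B.flip x) _
  rw [pfaffian, ← h, LinearMap.compMultilinearMap_alternatization]
  rfl

/-- The linear functional on `∧𝔤` that is given on `∧^{2k}` by the normalized Pfaffian. -/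
noncomputable def pfaffianFunctional : ExteriorAlgebra ℂ 𝔤 →ₗ[ℂ] ℂ :=
  ExteriorAlgebra.liftAlternating fun n =>
    -- The factor `n!` undoes `tauA_alternatization_tprod` and the power of `2` undoes
    -- `tau_bracketTensor`. Odd degrees are sent to zero.
    if h : 2 * (n / 2) = n then
      ((n.factorial : ℂ)⁻¹ * ((2 : ℂ) ^ (n / 2))⁻¹) •
        (pfaffian (kirillovForm B x) (n / 2)).domDomCongr (finCongr h)
    else 0

theorem pfaffianFunctional_ιMulti {k : ℕ} (v : Fin (2 * k) → 𝔤) :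
    pfaffianFunctional B x (ExteriorAlgebra.ιMulti ℂ (2 * k) v) =
      (((2 * k).factorial : ℂ)⁻¹ * ((2 : ℂ) ^ k)⁻¹) * pfaffian (kirillovForm B x) k v := by
  rw [pfaffianFunctional, ExteriorAlgebra.liftAlternating_apply_ιMulti]
  have hk : 2 * k / 2 = k := by omega
  rw [dif_pos (by omega)]
  have key : ∀ m (h : 2 * m = 2 * k), (pfaffian (kirillovForm B x) m).domDomCongr (finCongr h) v =
      pfaffian (kirillovForm B x) k v := by
    intro m h
    obtain rfl : m = k := by omega
    rfl
  rw [AlternatingMap.smul_apply, key, hk, smul_eq_mul]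

/-- Every even alternating tensor `t` has a symmetric `s` with `τ s = τ t`, with given values. -/
theorem exists_symmetric_lift {t : TensorAlgebra ℂ 𝔤} (ht : t ∈ evenAltTensors 𝔤) :
    ∃ s ∈ allSymTensors 𝔤, τ 𝔤 s = τ 𝔤 t ∧
      ∀ x, evalAt B x (τS 𝔤 s) = pfaffianFunctional B x (τA 𝔤 t) := by
  -- The required property is linear in `t`, so it suffices to check it on alternatized pure
  -- tensors, where the witness is `2⁻ᵏ • bracketTensor k v`.
  let G : Submodule ℂ (TensorAlgebra ℂ 𝔤) :=
    { carrier := {t | ∃ s ∈ allSymTensors 𝔤, τ 𝔤 s = τ 𝔤 t ∧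
        ∀ x, evalAt B x (τS 𝔤 s) = pfaffianFunctional B x (τA 𝔤 t)}
      zero_mem' := ⟨0, Submodule.zero_mem _, by simp, by simp⟩
      add_mem' := by
        rintro t t' ⟨s, hs, h1, h2⟩ ⟨s', hs', h1', h2'⟩
        exact ⟨s + s', Submodule.add_mem _ hs hs', by simp [h1, h1'], by simp [h2, h2']⟩
      smul_mem' := by
        rintro c t ⟨s, hs, h1, h2⟩
        exact ⟨c • s, Submodule.smul_mem _ _ hs, by simp [h1], by simp [h2]⟩ }
  suffices h : evenAltTensors 𝔤 ≤ G from h ht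
  refine iSup_le fun k => (altTensors_le_span _).trans ?_
  rw [Submodule.span_le]
  rintro _ ⟨v, rfl⟩
  have h2 : (2 : ℂ) ^ k ≠ 0 := pow_ne_zero _ two_ne_zero
  refine ⟨((2 : ℂ) ^ k)⁻¹ • bracketTensor k v, Submodule.smul_mem _ _
    (Submodule.mem_iSup_of_mem k (bracketTensor_mem_symTensors v)), ?_, fun x => ?_⟩
  · rw [map_smul, tau_bracketTensor, smul_smul, inv_mul_cancel₀ h2, one_smul]
  · have hn : ((2 * k).factorial : ℂ) ≠ 0 := Nat.cast_ne_zero.2 (Nat.factorial_ne_zero _)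
    rw [map_smul, map_smul, evalAt_bracketTensor, tauA_alternatization_tprod, map_smul,
      pfaffianFunctional_ιMulti, smul_eq_mul, smul_eq_mul]
    field_simp

/-- Injectivity of `τ` forces the chosen `ΓT t` to be the explicit symmetric lift. -/
theorem evalAt_Gamma (hτ : Set.InjOn (τ 𝔤) (allSymTensors 𝔤 : Set (TensorAlgebra ℂ 𝔤))) {k : ℕ}
    {u : ExteriorAlgebra ℂ 𝔤} (hu : u ∈ ⋀[ℂ]^(2 * k) 𝔤) :
    evalAt B x (Γ u) = pfaffianFunctional B x u := by
  have hex : ∃ t ∈ (evenAltTensors 𝔤 : Set (TensorAlgebra ℂ 𝔤)), τA 𝔤 t = u := by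
    obtain ⟨t, ht, h⟩ := exists_mem_altTensors hu
    exact ⟨t, Submodule.mem_iSup_of_mem k ht, h⟩
  have ht := Function.invFunOn_mem hex
  have htu := Function.invFunOn_eq hex
  rw [Γ]
  generalize Function.invFunOn (τA 𝔤) (evenAltTensors 𝔤 : Set (TensorAlgebra ℂ 𝔤)) u = t at ht htu
  obtain ⟨s, hs, hst, hev⟩ := exists_symmetric_lift B ht
  have hs' : ∃ a ∈ (allSymTensors 𝔤 : Set (TensorAlgebra ℂ 𝔤)), τ 𝔤 a = τ 𝔤 t := ⟨s, hs, hst⟩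
  have hΓ : ΓT t = s :=
    hτ (Function.invFunOn_mem hs') hs ((Function.invFunOn_eq hs').trans hst.symm)
  rw [hΓ, hev, htu]

theorem mem_Var_R_iff (hτ : Set.InjOn (τ 𝔤) (allSymTensors 𝔤 : Set (TensorAlgebra ℂ 𝔤))) (k : ℕ) :
    x ∈ Var B (R 𝔤 k) ↔ pfaffian (kirillovForm B x) k = 0 := by
  have h1 : x ∈ Var B (R 𝔤 k) ↔ ∀ u ∈ ⋀[ℂ]^(2 * k) 𝔤, pfaffianFunctional B x u = 0 := by
    rw [Var, R, Set.mem_ofPred_eq, Set.forall_mem_image]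
    exact forall₂_congr fun u hu => by rw [evalAt_Gamma B x hτ hu]
  have hn : ((2 * k).factorial : ℂ) ≠ 0 := Nat.cast_ne_zero.2 (Nat.factorial_ne_zero _)
  have h2 : (2 : ℂ) ^ k ≠ 0 := pow_ne_zero _ two_ne_zero
  rw [h1]
  constructor
  · intro h
    ext v
    have hv : ExteriorAlgebra.ιMulti ℂ (2 * k) v ∈ ⋀[ℂ]^(2 * k) 𝔤 := by
      rw [← exteriorPower.ιMulti_span_fixedDegree]
      exact Submodule.subset_span ⟨v, rfl⟩
    have := h _ hv
    rw [pfaffianFunctional_ιMulti] at this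
    exact (mul_eq_zero.1 this).resolve_left (mul_ne_zero (inv_ne_zero hn) (inv_ne_zero h2))
  · intro h
    suffices hle : ⋀[ℂ]^(2 * k) 𝔤 ≤ LinearMap.ker (pfaffianFunctional B x) from fun u hu => hle hu
    rw [← exteriorPower.ιMulti_span_fixedDegree, Submodule.span_le]
    rintro _ ⟨v, rfl⟩
    rw [SetLike.mem_coe, LinearMap.mem_ker, pfaffianFunctional_ιMulti, h, AlternatingMap.zero_apply,
      mul_zero]

/-- Invariance gives `B([y, z], x) = B(z, [x, y])`, so the form is `ad x` followed by the injective
map `B.flip`. -/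
theorem finrank_range_kirillovForm [FiniteDimensional ℂ 𝔤] (hB_nondeg : B.Nondegenerate)
    (hB_inv : B.lieInvariant 𝔤) :
    Module.finrank ℂ (LinearMap.range (kirillovForm B x)) =
      Module.finrank ℂ (LinearMap.range (LieAlgebra.ad ℂ 𝔤 x)) := by
  have h : kirillovForm B x = B.flip ∘ₗ LieAlgebra.ad ℂ 𝔤 x := by
    ext y z
    have := hB_inv y z x
    rw [kirillovForm_apply, this, ← lie_skew, map_neg, neg_neg]
    rfl
  have hinj : Function.Injective B.flip :=
    LinearMap.ker_eq_bot.1 (LinearMap.separatingRight_iff_flip_ker_eq_bot.1 hB_nondeg.2)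
  rw [h, LinearMap.range_comp]
  exact (LinearEquiv.finrank_eq (Submodule.equivMapOfInjective _ hinj _)).symm

end Gamma

/-! ### Strata as unions of sheets. -/

section Sheets

variable (𝔤 : Type*) [LieRing 𝔤] [LieAlgebra ℂ 𝔤]

theorem sUnion_sheets (d : ℕ) : ⋃₀ sheets 𝔤 d = stratum 𝔤 d := by
  let _ : TopologicalSpace (stratum 𝔤 d) :=
    TopologicalSpace.induced (Subtype.val : stratum 𝔤 d → 𝔤) (zariski 𝔤)
  apply Set.Subset.antisymm
  · rintro x ⟨_, ⟨C, -, rfl⟩, ⟨y, -, rfl⟩⟩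
    exact y.2
  · intro x hx
    exact ⟨_, ⟨irreducibleComponent (⟨x, hx⟩ : stratum 𝔤 d),
      irreducibleComponent_mem_irreducibleComponents _, rfl⟩,
      ⟨⟨x, hx⟩, mem_irreducibleComponent, rfl⟩⟩

end Sheets

/-! ### Vectors fixed by a one-parameter group of matrices. -/

section Exponential

open Matrix

variable {n : Type*} [Fintype n] [DecidableEq n]

attribute [local instance] Matrix.linftyOpNormedRing Matrix.linftyOpNormedAlgebra

theorem exp_mulVec_of_mulVec_eq_zero {M : Matrix n n ℂ} {v : n → ℂ} (h : M *ᵥ v = 0) :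
    NormedSpace.exp M *ᵥ v = v := by
  let φ : Matrix n n ℂ →L[ℂ] (n → ℂ) :=
    LinearMap.toContinuousLinearMap ((Matrix.mulVecBilin ℂ ℂ).flip v)
  have hφ : ∀ A, φ A = A *ᵥ v := fun _ => rfl
  have h1 := (NormedSpace.exp_series_hasSum_exp' (𝕂 := ℂ) M).mapL φ
  have h2 : HasSum (fun m : ℕ => φ ((m.factorial : ℂ)⁻¹ • M ^ m)) (φ ((Nat.factorial 0 : ℂ)⁻¹ • M ^ 0)) := by
    refine hasSum_single 0 fun m hm => ?_
    obtain ⟨m, rfl⟩ := Nat.exists_eq_succ_of_ne_zero hm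
    rw [hφ, Matrix.smul_mulVec, pow_succ, ← Matrix.mulVec_mulVec, h, Matrix.mulVec_zero, smul_zero]
  refine (h1.unique h2).trans ?_
  rw [hφ]
  simp

/-- Differentiate the constant curve `t ↦ exp (tM) v` at `t = 0`, one coordinate at a time. -/
theorem mulVec_eq_zero_of_exp_mulVec {M : Matrix n n ℂ} {v : n → ℂ}
    (h : ∀ t : ℝ, NormedSpace.exp ((t : ℂ) • M) *ᵥ v = v) : M *ᵥ v = 0 := by
  funext i
  let φ : Matrix n n ℂ →L[ℂ] ℂ := LinearMap.toContinuousLinearMap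
    (LinearMap.proj i ∘ₗ (Matrix.mulVecBilin ℂ ℂ).flip v)
  have h1 := (φ.hasFDerivAt.comp_hasDerivAt _
    (hasDerivAt_exp_smul_const M ((0 : ℝ) : ℂ))).comp_ofReal
  have h2 : HasDerivAt (fun _ : ℝ => v i) (φ (NormedSpace.exp (((0 : ℝ) : ℂ) • M) * M)) 0 :=
    h1.congr_of_eventuallyEq (Filter.Eventually.of_forall fun t => (congrFun (h t) i).symm)
  have h3 := h2.unique (hasDerivAt_const (0 : ℝ) (v i))
  rw [Complex.ofReal_zero, zero_smul, NormedSpace.exp_zero, one_mul] at h3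
  exact h3

end Exponential

/-! ### Stabilizers and dimensions of adjoint orbits. -/

section Orbits

variable {𝔤 : Type*} [LieRing 𝔤] [LieAlgebra ℂ 𝔤] [FiniteDimensional ℂ 𝔤]

theorem repr_expEnd (f : Module.End ℂ 𝔤) (x : 𝔤) :
    (Module.finBasis ℂ 𝔤).equivFun (expEnd f x) =
      (NormedSpace.exp (LinearMap.toMatrix (Module.finBasis ℂ 𝔤) (Module.finBasis ℂ 𝔤) f)).mulVec
        ((Module.finBasis ℂ 𝔤).equivFun x) := by
  rw [expEnd, Module.Basis.equivFun_apply, Module.Basis.equivFun_apply, Matrix.repr_toLin]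

theorem isUnit_expEnd (f : Module.End ℂ 𝔤) : IsUnit (expEnd f) :=
  (Matrix.isUnit_exp _).map (Matrix.toLinAlgEquiv (Module.finBasis ℂ 𝔤))

theorem equivFun_lie (y x : 𝔤) :
    (adMatrix y).mulVec ((Module.finBasis ℂ 𝔤).equivFun x) =
      (Module.finBasis ℂ 𝔤).equivFun ⁅y, x⁆ :=
  LinearMap.toMatrix_mulVec_repr _ _ (LieAlgebra.ad ℂ 𝔤 y) x

theorem adMatrix_smul (c : ℂ) (y : 𝔤) : adMatrix (c • y) = c • adMatrix y := by
  simp [adMatrix]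

theorem expEnd_ad_apply_eq_self_iff (x y : 𝔤) :
    (∀ t : ℝ, expEnd (LieAlgebra.ad ℂ 𝔤 ((t : ℂ) • y)) x = x) ↔ ⁅y, x⁆ = 0 := by
  have h : ∀ t : ℝ, expEnd (LieAlgebra.ad ℂ 𝔤 ((t : ℂ) • y)) x = x ↔
      (NormedSpace.exp ((t : ℂ) • adMatrix y)).mulVec ((Module.finBasis ℂ 𝔤).equivFun x) =
        (Module.finBasis ℂ 𝔤).equivFun x := fun t => by
    rw [← (Module.finBasis ℂ 𝔤).equivFun.injective.eq_iff, repr_expEnd, ← adMatrix_smul]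
    rfl
  simp only [h]
  rw [← (Module.finBasis ℂ 𝔤).equivFun.map_eq_zero_iff, ← equivFun_lie]
  refine ⟨mulVec_eq_zero_of_exp_mulVec, fun h0 t => exp_mulVec_of_mulVec_eq_zero ?_⟩
  rw [Matrix.smul_mulVec, h0, smul_zero]

/-- Each `exp (t ad y)` lies in the adjoint group by definition, so the only condition on `y` is
that these maps fix `x`, that is, `[y, x] = 0`. These `y` already form a subspace, and the span adds
nothing. -/
theorem isotropyAlgebra_eq_ker (x : 𝔤) :
    isotropyAlgebra x = LinearMap.ker (LieAlgebra.ad ℂ 𝔤 x : 𝔤 →ₗ[ℂ] 𝔤) := by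
  have hset : {y : 𝔤 | ∀ t : ℝ, ∃ g ∈ MulAction.stabilizer (adjointGroup 𝔤) x,
      ((g : (Module.End ℂ 𝔤)ˣ) : Module.End ℂ 𝔤) = expEnd (LieAlgebra.ad ℂ 𝔤 ((t : ℂ) • y))} =
      (LinearMap.ker (LieAlgebra.ad ℂ 𝔤 x : 𝔤 →ₗ[ℂ] 𝔤) : Set 𝔤) := by
    ext y
    have hker : y ∈ (LinearMap.ker (LieAlgebra.ad ℂ 𝔤 x : 𝔤 →ₗ[ℂ] 𝔤) : Set 𝔤) ↔ ⁅y, x⁆ = 0 := by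
      rw [SetLike.mem_coe, LinearMap.mem_ker, LieAlgebra.ad_apply, ← lie_skew, neg_eq_zero]
    rw [hker, ← expEnd_ad_apply_eq_self_iff]
    refine forall_congr' fun t => ⟨?_, fun h => ?_⟩
    · rintro ⟨g, hg, hgt⟩
      rw [← hgt]
      exact hg
    · obtain ⟨u, hu⟩ := isUnit_expEnd (LieAlgebra.ad ℂ 𝔤 ((t : ℂ) • y))
      refine ⟨⟨u, Subgroup.subset_closure ⟨_, hu⟩⟩, ?_, hu⟩
      rw [MulAction.mem_stabilizer_iff]
      change (u : Module.End ℂ 𝔤) x = x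
      rw [hu, h]
  rw [isotropyAlgebra, hset, Submodule.span_eq]

theorem orbitDim_eq (x : 𝔤) :
    orbitDim x = Module.finrank ℂ (LinearMap.range (LieAlgebra.ad ℂ 𝔤 x)) := by
  rw [orbitDim, isotropyAlgebra_eq_ker]
  exact (LinearMap.quotKerEquivRange _).finrank_eq

end Orbits

end Kostant

theorem theorem6 (𝔤 : Type*) [LieRing 𝔤] [LieAlgebra ℂ 𝔤] [FiniteDimensional ℂ 𝔤]
    [LieAlgebra.HasCentralRadical ℂ 𝔤]
    (B : LinearMap.BilinForm ℂ 𝔤) (hB_symm : B.IsSymm) (hB_nondeg : B.Nondegenerate)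
    (hB_inv : B.lieInvariant 𝔤) (k : ℕ) :
    Kostant.Var B (Kostant.R 𝔤 k) = (⋃ j < k, Kostant.stratum 𝔤 (2 * j)) ∧
    Kostant.Var B (Kostant.R 𝔤 k) = {x | Kostant.orbitDim x < 2 * k} ∧
    Kostant.Var B (Kostant.R 𝔤 k) = (⋃ j < k, ⋃₀ Kostant.sheets 𝔤 (2 * j)) := by
  have hτ := Kostant.tau_injOn_allSymTensors B hB_nondeg hB_inv
  have hmem : ∀ x, x ∈ Kostant.Var B (Kostant.R 𝔤 k) ↔
      Module.finrank ℂ (LinearMap.range (LieAlgebra.ad ℂ 𝔤 x)) < 2 * k := fun x => by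
    rw [Kostant.mem_Var_R_iff B x hτ, Kostant.pfaffian_eq_zero_iff (Kostant.kirillovForm_isAlt B x),
      Kostant.finrank_range_kirillovForm B x hB_nondeg hB_inv]
  have hstrata : Kostant.Var B (Kostant.R 𝔤 k) = ⋃ j < k, Kostant.stratum 𝔤 (2 * j) := by
    ext x
    simp only [hmem, Set.mem_iUnion, exists_prop]
    constructor
    · intro h
      -- Evenness of the rank is what lets the even strata alone cover all `x` with `dim [𝔤, x] <
      -- 2k`.
      obtain ⟨j, hj⟩ := Kostant.even_rank_of_isAlt (Kostant.kirillovForm_isAlt B x)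
      rw [Kostant.finrank_range_kirillovForm B x hB_nondeg hB_inv] at hj
      exact ⟨j, by omega, hj.trans (two_mul j).symm⟩
    · rintro ⟨j, hj, h⟩
      have h' : Module.finrank ℂ (LinearMap.range (LieAlgebra.ad ℂ 𝔤 x)) = 2 * j := h
      omega
  refine ⟨hstrata, ?_, ?_⟩
  · ext x
    rw [hmem, ← Kostant.orbitDim_eq]
    rfl
  · simp only [Kostant.sUnion_sheets]
    exact hstrata
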